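/- Let $G=(V,E)$ be a finite simple graph. A subset $A\subseteq V$ is called $3$-independent if every connected component of the induced subgraph $G[A]$ has at most $3$ vertices, and $\mathrm{Ind}_3(G)$ denotes the simplicial complex of all $3$-independent subsets of $V$. A block of $G$ is a maximal connected subgraph that remains connected upon the removal of any single vertex, and $G$ is a block graph if every block of $G$ is a complete graph. Let $T_3$ be the graph with vertices $x_1,\dots,x_9$ and edges $x_1x_2,\ x_2x_3,\ x_3x_4,\ x_3x_5,\ x_4x_5,\ x_5x_6,\ x_6x_7,\ x_4x_8,\ x_8x_9$. A (not necessarily pure) simplicial complex is shellable if its facets can be ordered $F_1,\dots,F_t$ such that for each $k>1$ the complex $\langle F_k\rangle\cap\langle F_1,\dots,F_{k-1}\rangle$ is pure of dimension $\dim F_k-1$, where $\langle\mathcal F\rangle$ is the complex generated by $\mathcal F$ (the empty set is a face, of dimension $-1$). (a) If $G$ is a block graph that has no induced subgraph isomorphic to $T_3$, then $\mathrm{Ind}_3(G)$ is shellable. (b) If $G$ is a forest, then $\mathrm{Ind}_3(G)$ is shellable. -/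

import Mathlib

/-! ### Simplicial complexes and (nonpure) shellability

Mathlib's complexes consist of nonempty faces only.  For shellability the empty set has to be
counted as a face, of dimension `-1`; `augFaces` puts it back. -/

namespace PreAbstractSimplicialComplex

/-- All faces of the complex, including the empty face. -/
def augFaces {V : Type*} (K : PreAbstractSimplicialComplex V) : Set (Finset V) :=
  insert ∅ K.faces

/-- The facets: faces that are maximal under inclusion. -/
def IsFacet {V : Type*} (K : PreAbstractSimplicialComplex V) (F : Finset V) : Prop :=
  Maximal (fun A => A ∈ K.augFaces) F

/-- The dimension of a face is its number of vertices minus one. -/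
def faceDim {V : Type*} (F : Finset V) : ℤ := (F.card : ℤ) - 1

/-- The complex is pure and `d`-dimensional: every facet has dimension `d`. -/
def IsPureOfDim {V : Type*} (K : PreAbstractSimplicialComplex V) (d : ℤ) : Prop :=
  ∀ F : Finset V, K.IsFacet F → faceDim F = d

/-- The simplicial complex `⟨𝓕⟩` generated by a family `𝓕` of finite sets: its faces are all the
subsets of members of `𝓕`. -/
def generatedBy {V : Type*} (𝓕 : Set (Finset V)) : PreAbstractSimplicialComplex V where
  faces := {A | A.Nonempty ∧ ∃ F ∈ 𝓕, A ⊆ F}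
  isRelLowerSet_faces := by
    rintro A ⟨hA, F, hF, hAF⟩
    exact ⟨hA, fun B hB hBne => ⟨hBne, F, hF, hB.trans hAF⟩⟩

/-- A (not necessarily pure) complex is shellable if its facets can be listed without repetition as
`F 0, F 1, …, F (t - 1)` so that for every `k > 0` the complex
`⟨F k⟩ ∩ ⟨F 0, …, F (k - 1)⟩` is pure of dimension `dim (F k) - 1`. -/
def IsShellable {V : Type*} (K : PreAbstractSimplicialComplex V) : Prop :=
  ∃ (t : ℕ) (F : Fin t → Finset V),
    Function.Injective F ∧
    (∀ A : Finset V, K.IsFacet A ↔ A ∈ Set.range F) ∧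
    ∀ k : Fin t, 0 < (k : ℕ) →
      (generatedBy {F k} ⊓ generatedBy (F '' {j | j < k})).IsPureOfDim (faceDim (F k) - 1)

end PreAbstractSimplicialComplex

namespace SimpleGraph

/-! ### The `r`-independence complex -/

/-- `A` is `r`-independent: every connected component of `G[A]` has at most `r` vertices. -/
def IsRIndepSet {V : Type*} (G : SimpleGraph V) (r : ℕ) (A : Finset V) : Prop :=
  ∀ c : (G.induce (A : Set V)).ConnectedComponent, c.supp.ncard ≤ r

theorem IsRIndepSet.mono {V : Type*} {G : SimpleGraph V} {r : ℕ} {A B : Finset V}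
    (hA : G.IsRIndepSet r A) (hBA : B ⊆ A) : G.IsRIndepSet r B := by
  intro c
  let f : G.induce (B : Set V) ↪g G.induce (A : Set V) :=
    G.induceHomOfLE (Finset.coe_subset.2 hBA)
  refine le_trans ?_ (hA (c.map f.toHom))
  refine Set.ncard_le_ncard_of_injOn f ?_ f.injective.injOn (Set.toFinite _)
  intro x hx
  rw [ConnectedComponent.mem_supp_iff] at hx ⊢
  rw [← hx]
  rfl

theorem isRIndepSet_of_card_le {V : Type*} (G : SimpleGraph V) {r : ℕ} {A : Finset V}
    (hA : A.card ≤ r) : G.IsRIndepSet r A := by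
  intro c
  refine le_trans (Set.ncard_le_card c.supp) ?_
  simpa using hA

/-- The `r`-independence complex `Ind_r(G)`, for `r ≥ 1`. -/
def indComplex {V : Type*} (G : SimpleGraph V) (r : ℕ) (hr : 1 ≤ r) :
    AbstractSimplicialComplex V where
  faces := {A | A.Nonempty ∧ G.IsRIndepSet r A}
  isRelLowerSet_faces := by
    rintro A ⟨hne, hA⟩
    exact ⟨hne, fun B hB hBne => ⟨hBne, hA.mono hB⟩⟩
  singleton_mem v := ⟨Finset.singleton_nonempty v, G.isRIndepSet_of_card_le (by simpa using hr)⟩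

/-! ### Block graphs -/

/-- A connected subgraph that remains connected when any one of its vertices is removed.
(`Preconnected` rather than `Connected` after the removal, so that one-vertex subgraphs are
included.) -/
def IsNonseparable {V : Type*} {G : SimpleGraph V} (H : G.Subgraph) : Prop :=
  H.Connected ∧ ∀ v ∈ H.verts, (H.deleteVerts {v}).Preconnected

/-- A block: a maximal nonseparable subgraph. -/
def IsBlock {V : Type*} {G : SimpleGraph V} (H : G.Subgraph) : Prop :=
  Maximal IsNonseparable H

/-- A block graph: every block is a complete graph. -/
def IsBlockGraph {V : Type*} (G : SimpleGraph V) : Prop :=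
  ∀ H : G.Subgraph, IsBlock H → H.coe = ⊤

/-! ### The graph `T₃` -/

/-- A triangle with a path of length two attached at each of its vertices; the vertex `x_i` of the
usual labelling `x_1, …, x_9` is `i - 1 : Fin 9`. -/
def graphT3 : SimpleGraph (Fin 9) :=
  fromEdgeSet {s(0, 1), s(1, 2), s(2, 3), s(2, 4), s(3, 4), s(4, 5), s(5, 6), s(3, 7), s(7, 8)}

end SimpleGraph

/-! The argument is an induction over links. Call a vertex `v` of the link of a face `S` simplicial
if each face `A ⊇ S` to which `v` cannot be added contains exactly one minimal obstruction `σ`. Then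
the facets containing `S` can be ranked: those through `v` come first (recursively, over `insert v
S`), the others are grouped by their obstruction `σ` and ranked recursively over `S ∪ σ`. A facet
`F` missing `v` is compared with a facet not containing its `σ` by trading some `w ∈ σ` for `v`. So
it suffices that every face with a nonempty link has such a vertex
(`exists_rank_of_isLinkSimplicial`, `isShellable_of_rank`).

For `3`-independent sets, `v` is simplicial as soon as its neighbours that can be added to `S` form
a clique: then removing `v` from its component keeps the rest connected, so that component has at
most four vertices. If no vertex has this property, take an addable vertex outside `S` as far as
possible from a root of its component. It must have a neighbour in `S` one level higher, and every
triangle inside an independent `A ⊇ S` has an arm of length two at each vertex outside `S`. A third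
arm would complete an induced `T₃`, and this excludes the configurations with two competing
obstructions. The cases are `isLinkSimplicial_of_pair` and `isLinkSimplicial_of_triple`.

Block graphs and forests enter only through `HasCliqueBranches`; a forest has no `T₃` because it has
no triangle. -/

namespace PreAbstractSimplicialComplex

/-! ### Shellability from simplicial vertices of links -/

variable {V : Type*} [DecidableEq V]

/-- The exchange condition on a list of facets that is equivalent to being a shelling makes sense
for a rank function on facets, ties being allowed. -/
theorem isShellable_of_rank [Finite V] (K : PreAbstractSimplicialComplex V) (r : Finset V → ℕ)
    (hr : ∀ F F', K.IsFacet F → K.IsFacet F' → F' ≠ F → r F' ≤ r F →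
      ∃ F'', K.IsFacet F'' ∧ r F'' < r F ∧ ∃ w ∈ F, w ∉ F' ∧ F \ F'' = {w}) :
    K.IsShellable := by
  classical
  have := Fintype.ofFinite V
  let e := Fintype.equivFin {F : Finset V // K.IsFacet F}
  -- Ties are broken arbitrarily: the exchange facet has strictly smaller rank, so it precedes `F`
  -- in any sorted order.
  let τ := Tuple.sort fun i => r (e.symm i).1
  have hmono : Monotone fun i => r (e.symm (τ i)).1 := Tuple.monotone_sort fun i => r (e.symm i).1
  refine ⟨_, fun i => (e.symm (τ i)).1, ?_, ?_, ?_⟩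
  · intro i j hij
    exact τ.injective (e.symm.injective (Subtype.ext hij))
  · intro A
    constructor
    · intro hA
      exact ⟨τ.symm (e ⟨A, hA⟩), by simp⟩
    · rintro ⟨i, rfl⟩
      exact (e.symm (τ i)).2
  · intro k hk A hA
    have key : ∃ j, j < k ∧ A ⊆ (e.symm (τ k)).1 ∧ A ⊆ (e.symm (τ j)).1 := by
      rcases hA.prop with rfl | h
      · exact ⟨⟨0, by omega⟩, hk, Finset.empty_subset _, Finset.empty_subset _⟩
      · obtain ⟨⟨-, F, hF, h1⟩, -, F', ⟨j, hj, rfl⟩, h2⟩ := h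
        rw [Set.mem_singleton_iff] at hF
        subst hF
        exact ⟨j, hj, h1, h2⟩
    obtain ⟨j, hj, h1, h2⟩ := key
    have hne : (e.symm (τ j)).1 ≠ (e.symm (τ k)).1 := fun h =>
      hj.ne (τ.injective (e.symm.injective (Subtype.ext h)))
    obtain ⟨F'', hF'', hlt, w, hw, hw', hd⟩ :=
      hr _ _ (e.symm (τ k)).2 (e.symm (τ j)).2 hne (hmono hj.le)
    have hl : τ.symm (e ⟨F'', hF''⟩) < k := by
      by_contra! h
      have := hmono h
      simp at this
      omega
    have hsub : (e.symm (τ k)).1.erase w ⊆ F'' := by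
      intro z hz
      rw [Finset.mem_erase] at hz
      by_contra hz'
      have : z ∈ (e.symm (τ k)).1 \ F'' := Finset.mem_sdiff.2 ⟨hz.2, hz'⟩
      rw [hd, Finset.mem_singleton] at this
      exact hz.1 this
    have hAB : A ⊆ (e.symm (τ k)).1.erase w := fun z hz =>
      Finset.mem_erase.2 ⟨fun h => hw' (h ▸ h2 hz), h1 hz⟩
    have hB : (e.symm (τ k)).1.erase w ∈ (generatedBy {(e.symm (τ k)).1} ⊓ generatedBy
        ((fun i => (e.symm (τ i)).1) '' {j | j < k})).augFaces := by
      rcases Finset.eq_empty_or_nonempty ((e.symm (τ k)).1.erase w) with h | h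
      · exact Or.inl h
      · exact Or.inr ⟨⟨h, _, rfl, Finset.erase_subset _ _⟩, h, F'',
          ⟨_, hl, by simp⟩, hsub⟩
    have hEq : A = (e.symm (τ k)).1.erase w := le_antisymm hAB (hA.le_of_ge hB hAB)
    have hpos : 0 < (e.symm (τ k)).1.card := Finset.card_pos.2 ⟨w, hw⟩
    rw [hEq, faceDim, faceDim, Finset.card_erase_of_mem hw]
    dsimp only
    omega

/-- `v` is a simplicial vertex of the link of `S` in the family `Δ`: each face of `Δ` containing
`S` contains at most one minimal obstruction, relative to `S`, to adding `v`. -/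
def IsLinkSimplicial (Δ : Finset V → Prop) (S : Finset V) (v : V) : Prop :=
  ∀ A, S ⊆ A → Δ A → v ∉ A → ¬ Δ (insert v A) →
    ∃ σ, σ ⊆ A \ S ∧ ¬ Δ (insert v (S ∪ σ)) ∧ ∀ w ∈ σ, Δ ((insert v A).erase w)

/-- Induction on the number of vertices outside `S`. Groups of facets with different obstructions
need not be ordered among themselves, which is why a rank with ties is more convenient than a list.
-/
theorem exists_rank_of_isLinkSimplicial [Finite V] (Δ : Finset V → Prop)
    (hmono : ∀ A B, B ⊆ A → Δ A → Δ B)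
    (H : ∀ S, Δ S → (∃ v, v ∉ S ∧ Δ (insert v S)) →
      ∃ v, v ∉ S ∧ Δ (insert v S) ∧ IsLinkSimplicial Δ S v)
    (S : Finset V) (hS : Δ S) :
    ∃ r : Finset V → ℕ, ∀ F F', Maximal Δ F → Maximal Δ F' → S ⊆ F → S ⊆ F' → F' ≠ F →
      r F' ≤ r F →
      ∃ F'', Maximal Δ F'' ∧ S ⊆ F'' ∧ r F'' < r F ∧ ∃ w ∈ F, w ∉ F' ∧ F \ F'' = {w} := by
  classical
  have := Fintype.ofFinite V
  induction hn : Fintype.card V - S.card using Nat.strong_induction_on generalizing S with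
  | _ n ih =>
  by_cases hex : ∃ v, v ∉ S ∧ Δ (insert v S)
  swap
  · have hmax : ∀ F, Maximal Δ F → S ⊆ F → F = S := by
      intro F hF hSF
      by_contra hne
      obtain ⟨v, hv, hvS⟩ := Finset.exists_of_ssubset (hSF.ssubset_of_ne (Ne.symm hne))
      exact hex ⟨v, hvS, hmono _ _ (Finset.insert_subset hv hSF) hF.prop⟩
    refine ⟨fun _ => 0, fun F F' hF hF' h h' hne _ => absurd ?_ hne⟩
    rw [hmax F hF h, hmax F' hF' h']
  obtain ⟨v, hvS, hv, hsim⟩ := H S hS hex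
  -- The conditions on `S'` are moved behind the existential, with a dummy rank where they fail, so
  -- that `choose` gives one rank for every `S'`.
  have ih' : ∀ S', ∃ r : Finset V → ℕ, S ⊂ S' → Δ S' →
      ∀ F F', Maximal Δ F → Maximal Δ F' → S' ⊆ F → S' ⊆ F' → F' ≠ F → r F' ≤ r F →
      ∃ F'', Maximal Δ F'' ∧ S' ⊆ F'' ∧ r F'' < r F ∧ ∃ w ∈ F, w ∉ F' ∧ F \ F'' = {w} := by
    intro S'
    by_cases h : S ⊂ S' ∧ Δ S'
    · have h1 := Finset.card_lt_card h.1
      have h2 := Finset.card_le_univ S'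
      obtain ⟨r, hr⟩ := ih (Fintype.card V - S'.card) (by omega) S' h.2 rfl
      exact ⟨r, fun _ _ => hr⟩
    · exact ⟨fun _ => 0, fun h1 h2 => absurd ⟨h1, h2⟩ h⟩
  choose R hR using ih'
  have hσ : ∀ F, ∃ σ, Maximal Δ F → S ⊆ F → v ∉ F →
      σ ⊆ F \ S ∧ ¬ Δ (insert v (S ∪ σ)) ∧ ∀ w ∈ σ, Δ ((insert v F).erase w) := by
    intro F
    by_cases h : Maximal Δ F ∧ S ⊆ F ∧ v ∉ F
    · obtain ⟨hF, hSF, hvF⟩ := h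
      have hn : ¬ Δ (insert v F) := fun h =>
        hvF (hF.le_of_ge h (Finset.subset_insert v F) (Finset.mem_insert_self v F))
      obtain ⟨σ, h⟩ := hsim F hSF hF.prop hvF hn
      exact ⟨σ, fun _ _ _ => h⟩
    · exact ⟨∅, fun h1 h2 h3 => absurd ⟨h1, h2, h3⟩ h⟩
  choose σ hσ using hσ
  have hclass : ∀ F F', Maximal Δ F → Maximal Δ F' → S ⊆ F → S ⊆ F' → v ∉ F → v ∉ F' →
      S ∪ σ F ⊆ F' → σ F' = σ F := by
    intro F F' hF hF' hSF hSF' hvF hvF' hsub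
    obtain ⟨a1, a2, a3⟩ := hσ F hF hSF hvF
    obtain ⟨b1, b2, b3⟩ := hσ F' hF' hSF' hvF'
    -- A vertex whose deletion makes `insert v A` a face lies in every obstruction inside `A`.
    -- Applied both ways, this gives uniqueness of `σ`.
    have hone : ∀ (A T : Finset V), v ∉ A → T ⊆ A → ¬ Δ (insert v T) →
        ∀ w, w ∈ A → Δ ((insert v A).erase w) → w ∈ T := by
      intro A T hvA hTA hT w hwA hw
      by_contra hwT
      refine hT (hmono _ _ ?_ hw)
      intro z hz
      rw [Finset.mem_insert] at hz
      rw [Finset.mem_erase, Finset.mem_insert]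
      rcases hz with rfl | hz
      · exact ⟨fun h => hvA (h ▸ hwA), Or.inl rfl⟩
      · exact ⟨fun h => hwT (h ▸ hz), Or.inr (hTA hz)⟩
    have hle : σ F' ⊆ σ F := by
      intro w hw
      have hw' := Finset.mem_sdiff.1 (b1 hw)
      have := hone F' (S ∪ σ F) hvF' hsub a2 w hw'.1 (b3 w hw)
      exact (Finset.mem_union.1 this).resolve_left hw'.2
    refine hle.antisymm fun w hw => ?_
    have hw' := Finset.mem_sdiff.1 (a1 hw)
    have hsub' : S ∪ σ F' ⊆ F :=
      Finset.union_subset hSF (hle.trans (a1.trans Finset.sdiff_subset))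
    have := hone F (S ∪ σ F') hvF hsub' b2 w hw'.1 (a3 w hw)
    exact (Finset.mem_union.1 this).resolve_left hw'.2
  obtain ⟨B, hB⟩ : ∃ B, ∀ F, R (insert v S) F < B := by
    refine ⟨Finset.univ.sup (R (insert v S)) + 1, fun F => Nat.lt_succ_of_le ?_⟩
    exact Finset.le_sup (Finset.mem_univ F)
  have hSv : S ⊂ insert v S := Finset.ssubset_insert hvS
  -- The shift by `B` puts every facet through `v` strictly before every facet missing `v`.
  refine ⟨fun F => if v ∈ F then R (insert v S) F else B + R (S ∪ σ F) F, ?_⟩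
  intro F F' hF hF' hSF hSF' hne hle
  by_cases hvF : v ∈ F
  · have hvF' : v ∈ F' := by
      by_contra h
      have := hB F
      simp only [hvF, h, if_true, if_false] at hle
      omega
    simp only [hvF, hvF', if_true] at hle ⊢
    obtain ⟨F'', h1, h2, h3, h4⟩ := hR (insert v S) hSv hv F F' hF hF'
      (Finset.insert_subset hvF hSF) (Finset.insert_subset hvF' hSF') hne hle
    refine ⟨F'', h1, (Finset.subset_insert v S).trans h2, ?_, h4⟩
    simpa [h2 (Finset.mem_insert_self v S)] using h3
  obtain ⟨a1, a2, a3⟩ := hσ F hF hSF hvF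
  have hsubF : S ∪ σ F ⊆ F := Finset.union_subset hSF (a1.trans Finset.sdiff_subset)
  by_cases hsub : S ∪ σ F ⊆ F'
  · have hnv : ∀ F'', Maximal Δ F'' → S ∪ σ F ⊆ F'' → v ∉ F'' := fun F'' h h' hv' =>
      a2 (hmono _ _ (Finset.insert_subset hv' h') h.prop)
    have hvF' := hnv F' hF' hsub
    simp only [hvF, hvF', if_false, hclass F F' hF hF' hSF hSF' hvF hvF' hsub] at hle ⊢
    have hss : S ⊂ S ∪ σ F := by
      refine Finset.subset_union_left.ssubset_of_ne fun h => a2 ?_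
      rwa [← h]
    obtain ⟨F'', h1, h2, h3, h4⟩ := hR (S ∪ σ F) hss (hmono _ _ hsubF hF.prop) F F' hF hF'
      hsubF hsub hne (by omega)
    have hvF'' := hnv F'' h1 h2
    have hSF'' := Finset.subset_union_left.trans h2
    refine ⟨F'', h1, hSF'', ?_, h4⟩
    simp only [hvF'', if_false, hclass F F'' hF h1 hSF hSF'' hvF hvF'' h2]
    omega
  -- Trading `w` for `v` gives a face; any facet above it contains `v`, hence has smaller rank, and
  -- misses only `w` from `F`.
  · obtain ⟨w, hw, hwF'⟩ : ∃ w ∈ σ F, w ∉ F' := by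
      by_contra! h
      exact hsub (Finset.union_subset hSF' h)
    have hwF : w ∈ F := hsubF (Finset.mem_union_right _ hw)
    obtain ⟨F'', hle'', hF''⟩ := (Set.toFinite {A | Δ A}).exists_le_maximal (a3 w hw)
    have hvF'' : v ∈ F'' := hle'' (Finset.mem_erase.2
      ⟨fun h => hvF (h ▸ hwF), Finset.mem_insert_self v F⟩)
    have hsub'' : ∀ z ∈ F, z ≠ w → z ∈ F'' := fun z hz hzw =>
      hle'' (Finset.mem_erase.2 ⟨hzw, Finset.mem_insert_of_mem hz⟩)
    have hwF'' : w ∉ F'' := by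
      intro hw''
      have hFF'' : F ⊆ F'' := fun z hz => by
        by_cases h : z = w
        · exact h ▸ hw''
        · exact hsub'' z hz h
      exact hvF (hF.le_of_ge hF''.prop hFF'' hvF'')
    refine ⟨F'', hF'', fun z hz => hsub'' z (hSF hz) ?_, ?_, w, hwF, hwF', ?_⟩
    · rintro rfl
      exact (Finset.mem_sdiff.1 (a1 hw)).2 hz
    · have := hB F''
      simp only [hvF, hvF'', if_true, if_false]
      omega
    · ext z
      rw [Finset.mem_sdiff, Finset.mem_singleton]
      constructor
      · rintro ⟨h1, h2⟩
        by_contra h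
        exact h2 (hsub'' z h1 h)
      · rintro rfl
        exact ⟨hwF, hwF''⟩

end PreAbstractSimplicialComplex

/-! ### Connected vertex sets and independence -/

namespace SimpleGraph

variable {V : Type*} {G : SimpleGraph V}

/-- A finite vertex set which induces a preconnected subgraph: every nontrivial cut is crossed by an
edge. -/
def IsConnSet (G : SimpleGraph V) (T : Finset V) : Prop :=
  ∀ X ⊆ T, X.Nonempty → X ≠ T → ∃ a ∈ X, ∃ b ∈ T, b ∉ X ∧ G.Adj a b

theorem isConnSet_singleton (a : V) : G.IsConnSet {a} := by
  intro X hX hne hX'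
  rcases Finset.subset_singleton_iff.1 hX with rfl | rfl
  · simp at hne
  · exact absurd rfl hX'

/-- A connected set that meets a set `P` none of whose vertices has a neighbour in `T \ P` lies
inside `P`. -/
theorem IsConnSet.subset_of_closed {T P : Finset V} (hT : G.IsConnSet T) {t : V} (ht : t ∈ T)
    (htP : t ∈ P) (h : ∀ a ∈ P, ∀ b ∈ T, G.Adj a b → b ∈ P) : T ⊆ P := by
  classical
  by_contra hne
  obtain ⟨a, ha, b, hb, hb', hab⟩ := hT (T ∩ P) Finset.inter_subset_left
    ⟨t, Finset.mem_inter.2 ⟨ht, htP⟩⟩ (fun h => hne (Finset.inter_eq_left.1 h))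
  exact hb' (Finset.mem_inter.2 ⟨hb, h a (Finset.mem_inter.1 ha).2 b hb hab⟩)

/-- A cut is crossed if and only if its complement is, so only the side containing `t` has to be
tested. -/
theorem isConnSet_of_forall_mem {T : Finset V} {t : V} (ht : t ∈ T)
    (h : ∀ P ⊆ T, t ∈ P → (∀ a ∈ P, ∀ b ∈ T, G.Adj a b → b ∈ P) → T ⊆ P) : G.IsConnSet T := by
  classical
  intro X hX hne hXT
  by_contra! hcut
  by_cases htX : t ∈ X
  · exact hXT (hX.antisymm (h X hX htX fun a ha b hb hab => by
      by_contra hb'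
      exact hcut a ha b hb hb' hab))
  · obtain ⟨x, hx⟩ := hne
    have := h (T \ X) Finset.sdiff_subset (Finset.mem_sdiff.2 ⟨ht, htX⟩) fun a ha b hb hab => by
      rw [Finset.mem_sdiff] at ha ⊢
      exact ⟨hb, fun hb' => hcut b hb' a ha.1 ha.2 hab.symm⟩
    exact (Finset.mem_sdiff.1 (this (hX hx))).2 hx

protected theorem IsConnSet.insert [DecidableEq V] {T : Finset V} (hT : G.IsConnSet T) {a b : V} (ha : a ∈ T)
    (hab : G.Adj a b) : G.IsConnSet (insert b T) := by
  refine isConnSet_of_forall_mem (Finset.mem_insert_of_mem ha) fun P hP haP hcl => ?_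
  refine Finset.insert_subset (hcl a haP b (Finset.mem_insert_self _ _) hab) ?_
  exact hT.subset_of_closed ha haP fun x hx y hy => hcl x hx y (Finset.mem_insert_of_mem hy)

theorem exists_component [DecidableEq V] {A : Finset V} {u : V} (hu : u ∈ A) :
    ∃ Q ⊆ A, u ∈ Q ∧ G.IsConnSet Q ∧ ∀ a ∈ Q, ∀ b ∈ A, G.Adj a b → b ∈ Q := by
  have hfin : {T : Finset V | T ⊆ A ∧ u ∈ T ∧ G.IsConnSet T}.Finite :=
    A.powerset.finite_toSet.subset fun T hT => by simpa using hT.1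
  obtain ⟨Q, -, hQ⟩ := hfin.exists_le_maximal (a := {u})
    ⟨by simpa using hu, by simp, isConnSet_singleton u⟩
  obtain ⟨hQA, huQ, hQc⟩ := hQ.prop
  refine ⟨Q, hQA, huQ, hQc, fun a ha b hb hab => ?_⟩
  exact hQ.le_of_ge (y := insert b Q) ⟨Finset.insert_subset hb hQA, Finset.mem_insert_of_mem huQ,
    hQc.insert ha hab⟩ (Finset.subset_insert b Q) (Finset.mem_insert_self b Q)

theorem isRIndepSet_iff {r : ℕ} {A : Finset V} :
    G.IsRIndepSet r A ↔ ∀ T ⊆ A, G.IsConnSet T → T.card ≤ r := by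
  classical
  constructor
  · intro hA T hTA hT
    rcases T.eq_empty_or_nonempty with rfl | ⟨t, ht⟩
    · simp
    let c := (G.induce (A : Set V)).connectedComponentMk ⟨t, hTA ht⟩
    have hsub : T ⊆ T.filter fun x => ∃ h : x ∈ A, (⟨x, h⟩ : (A : Set V)) ∈ c.supp := by
      refine hT.subset_of_closed ht (by simp [ht, hTA ht, c]) fun a ha b hb hab => ?_
      rw [Finset.mem_filter] at ha ⊢
      obtain ⟨-, haA, ha⟩ := ha
      refine ⟨hb, hTA hb, ?_⟩
      exact c.mem_supp_of_adj_mem_supp ha hab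
    refine le_trans ?_ (hA c)
    rw [← Set.ncard_image_of_injective c.supp Subtype.val_injective, ← Set.ncard_coe_finset]
    refine Set.ncard_le_ncard (fun x hx => ?_) (Set.toFinite _)
    obtain ⟨-, h, h'⟩ := Finset.mem_filter.1 (hsub hx)
    exact ⟨⟨x, h⟩, h', rfl⟩
  · intro H c
    have hmem : ∀ x, x ∈ A.filter (fun x => ∃ h : x ∈ A, (⟨x, h⟩ : (A : Set V)) ∈ c.supp) ↔
        ∃ h : x ∈ A, (⟨x, h⟩ : (A : Set V)) ∈ c.supp := by
      intro x
      rw [Finset.mem_filter]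
      exact ⟨fun h => h.2, fun h => ⟨h.1, h⟩⟩
    refine le_trans (le_of_eq ?_) (H (A.filter fun x => ∃ h : x ∈ A, (⟨x, h⟩ : (A : Set V)) ∈ c.supp)
      (Finset.filter_subset _ _) ?_)
    · rw [← Set.ncard_image_of_injective c.supp Subtype.val_injective, ← Set.ncard_coe_finset]
      congr 1
      ext x
      rw [Finset.mem_coe, hmem]
      constructor
      · rintro ⟨y, hy, rfl⟩
        exact ⟨y.2, hy⟩
      · rintro ⟨h, h'⟩
        exact ⟨⟨x, h⟩, h', rfl⟩
    · obtain ⟨⟨t, htA⟩, ht⟩ := c.nonempty_supp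
      refine isConnSet_of_forall_mem ((hmem t).2 ⟨htA, ht⟩) fun P hP htP hcl x hx => ?_
      obtain ⟨hxA, hx⟩ := (hmem x).1 hx
      by_contra hxP
      obtain ⟨p⟩ := ConnectedComponent.exact (ht.trans hx.symm)
      obtain ⟨d, -, hd1, hd2⟩ := p.exists_boundary_dart {y | y.1 ∈ P} htP hxP
      obtain ⟨h1, h2⟩ := (hmem _).1 (hP hd1)
      exact hd2 (hcl _ hd1 _ ((hmem _).2
        ⟨d.snd.2, c.mem_supp_of_adj_mem_supp h2 d.adj⟩) d.adj)

theorem IsConnSet.exists_path {T : Finset V} (hT : G.IsConnSet T) {a b : V} (ha : a ∈ T)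
    (hb : b ∈ T) : ∃ p : G.Walk a b, p.IsPath ∧ ∀ x ∈ p.support, x ∈ T := by
  classical
  have hsub : T ⊆ T.filter fun x => ∃ p : G.Walk a x, ∀ y ∈ p.support, y ∈ T := by
    refine hT.subset_of_closed ha ?_ fun x hx y hy hxy => ?_
    · exact Finset.mem_filter.2 ⟨ha, Walk.nil, by simpa using ha⟩
    · obtain ⟨-, p, hp⟩ := Finset.mem_filter.1 hx
      refine Finset.mem_filter.2 ⟨hy, p.concat hxy, fun z hz => ?_⟩
      rw [Walk.support_concat, List.mem_append, List.mem_singleton] at hz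
      rcases hz with hz | rfl
      · exact hp z hz
      · exact hy
  obtain ⟨-, p, hp⟩ := Finset.mem_filter.1 (hsub hb)
  exact ⟨p.bypass, p.bypass_isPath, fun x hx => hp x (p.support_bypass_subset_support hx)⟩

/-! ### Branches at a vertex in forests and block graphs -/

/-- Two neighbours of a vertex `v` that are connected in `G - v` are adjacent: an intrinsic
description of block graphs. -/
def HasCliqueBranches (G : SimpleGraph V) : Prop :=
  ∀ ⦃v a b : V⦄ (T : Finset V), G.Adj v a → G.Adj v b → a ≠ b → G.IsConnSet T → a ∈ T → b ∈ T →
    v ∉ T → G.Adj a b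

/-- A path from `a` to `b` in `T`, prolonged to `v`, must coincide with the edge `vb`, so it has
length zero. -/
theorem IsAcyclic.eq_of_isConnSet (hG : G.IsAcyclic) {v a b : V} (T : Finset V) (ha : G.Adj v a)
    (hb : G.Adj v b) (hT : G.IsConnSet T) (haT : a ∈ T) (hbT : b ∈ T) (hvT : v ∉ T) : a = b := by
  obtain ⟨p, hp, hpT⟩ := hT.exists_path haT hbT
  have hv : v ∉ p.support := fun h => hvT (hpT v h)
  have h1 : (Walk.cons ha p).IsPath := hp.cons hv
  have h2 : (Walk.cons hb Walk.nil).IsPath := Walk.IsPath.nil.cons (by simpa using hb.ne)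
  have := (hG.subsingleton_path v b).elim ⟨_, h1⟩ ⟨_, h2⟩
  have hlen := congrArg (fun q : G.Path v b => q.1.length) this
  simp only [Walk.length_cons, Walk.length_nil] at hlen
  exact Walk.eq_of_length_eq_zero (p := p) (by omega)

theorem IsAcyclic.hasCliqueBranches (hG : G.IsAcyclic) : G.HasCliqueBranches :=
  fun _ _ _ T ha hb hne hT haT hbT hvT =>
    absurd (hG.eq_of_isConnSet T ha hb hT haT hbT hvT) hne

theorem preconnected_top_induce {W : Set V} {t : V}
    (h : ∀ w ∈ W, ∃ p : G.Walk w t, ∀ x ∈ p.support, x ∈ W) :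
    ((⊤ : G.Subgraph).induce W).Preconnected := by
  rw [Subgraph.preconnected_iff_forall_exists_walk_subgraph]
  intro u v hu hv
  obtain ⟨p, hp⟩ := h u hu
  obtain ⟨q, hq⟩ := h v hv
  refine ⟨p.append q.reverse, (Walk.toSubgraph_le_induce_support _).trans
    (Subgraph.induce_mono_right fun x hx => ?_)⟩
  rw [Set.mem_ofPred_eq, Walk.mem_support_append_iff, Walk.support_reverse, List.mem_reverse] at hx
  exact hx.elim (hp x) (hq x)

/-- A path together with a vertex adjacent to its two ends spans a nonseparable subgraph. -/
theorem isNonseparable_induce_path {v a b : V} (ha : G.Adj v a) (hb : G.Adj v b)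
    (p : G.Walk a b) (hp : p.IsPath) (hv : v ∉ p.support) :
    IsNonseparable ((⊤ : G.Subgraph).induce {x | x = v ∨ x ∈ p.support}) := by
  classical
  refine ⟨Subgraph.connected_iff.2 ⟨preconnected_top_induce (t := v) ?_, ⟨v, Or.inl rfl⟩⟩, ?_⟩
  · rintro w (rfl | hw)
    · exact ⟨Walk.nil, by simp⟩
    · refine ⟨(p.takeUntil w hw).reverse.concat ha.symm, fun x hx => ?_⟩
      rw [Walk.support_concat, List.mem_append, List.mem_singleton,
        Walk.support_reverse, List.mem_reverse] at hx
      exact hx.elim (fun h => Or.inr (p.support_takeUntil_subset_support hw h)) Or.inl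
  · intro u _
    have hdel : ((⊤ : G.Subgraph).induce {x | x = v ∨ x ∈ p.support}).deleteVerts {u} =
        (⊤ : G.Subgraph).induce ({x | x = v ∨ x ∈ p.support} \ {u}) := by
      ext x y
      · simp
      · simp only [Subgraph.induce_verts, Subgraph.induce_adj,
          Set.mem_sdiff]
        tauto
    rw [hdel]
    by_cases huv : u = v
    · subst huv
      refine preconnected_top_induce (t := a) ?_
      rintro w ⟨rfl | hw, hwu⟩
      · exact absurd rfl hwu
      refine ⟨(p.takeUntil w hw).reverse, fun x hx => ?_⟩
      rw [Walk.support_reverse, List.mem_reverse] at hx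
      have hx' := p.support_takeUntil_subset_support hw hx
      exact ⟨Or.inr hx', fun h => hv (h ▸ hx')⟩
    · refine preconnected_top_induce (t := v) ?_
      rintro w ⟨rfl | hw, hwu⟩
      · exact ⟨Walk.nil, by simpa using Ne.symm huv⟩
      -- The deleted vertex `u` lies on at most one side of `w` along the path; `v` is reached along
      -- the other side.
      by_cases h1 : u ∈ (p.takeUntil w hw).support
      · have h2 : u ∉ (p.dropUntil w hw).support := by
          intro h2
          have hnd := hp.support_nodup
          rw [← p.take_spec hw, Walk.support_append] at hnd
          rw [← Walk.cons_tail_support, List.mem_cons] at h2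
          rcases h2 with rfl | h2
          · exact hwu rfl
          · exact List.disjoint_of_nodup_append hnd h1 h2
        refine ⟨(p.dropUntil w hw).concat hb.symm, fun x hx => ?_⟩
        rw [Walk.support_concat, List.mem_append, List.mem_singleton] at hx
        rcases hx with hx | rfl
        · exact ⟨Or.inr (p.support_dropUntil_subset_support hw hx), fun h => h2 (h ▸ hx)⟩
        · exact ⟨Or.inl rfl, Ne.symm huv⟩
      · refine ⟨(p.takeUntil w hw).reverse.concat ha.symm, fun x hx => ?_⟩
        rw [Walk.support_concat, List.mem_append, List.mem_singleton,
          Walk.support_reverse, List.mem_reverse] at hx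
        rcases hx with hx | rfl
        · exact ⟨Or.inr (p.support_takeUntil_subset_support hw hx), fun h => h1 (h ▸ hx)⟩
        · exact ⟨Or.inl rfl, Ne.symm huv⟩

/-- A path from `a` to `b` avoiding `v` spans, together with `v`, a nonseparable subgraph; a block
containing it is complete. -/
theorem IsBlockGraph.hasCliqueBranches [Finite V] (hG : G.IsBlockGraph) :
    G.HasCliqueBranches := by
  intro v a b T ha hb hne hT haT hbT hvT
  obtain ⟨p, hp, hpT⟩ := hT.exists_path haT hbT
  have hv : v ∉ p.support := fun h => hvT (hpT v h)
  obtain ⟨H, hle, hH⟩ := (Set.toFinite {H : G.Subgraph | IsNonseparable H}).exists_le_maximal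
    (isNonseparable_induce_path ha hb p hp hv)
  have haH : a ∈ H.verts := hle.1 (Or.inr p.start_mem_support)
  have hbH : b ∈ H.verts := hle.1 (Or.inr p.end_mem_support)
  have hadj : H.coe.Adj ⟨a, haH⟩ ⟨b, hbH⟩ := by
    rw [hG H hH, top_adj]
    exact fun h => hne (congrArg Subtype.val h)
  exact H.adj_sub hadj

/-! ### Heights -/

/-- A height function, modelled on the distance to a root: among the neighbours of a vertex, those
not above it are pairwise adjacent and at most one is strictly below. -/
structure IsHeight (G : SimpleGraph V) (h : V → ℕ) : Prop where
  le_succ : ∀ ⦃u w⦄, G.Adj u w → h w ≤ h u + 1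
  adj : ∀ ⦃u a b⦄, G.Adj u a → G.Adj u b → a ≠ b → h a ≤ h u → h b ≤ h u → G.Adj a b
  unique : ∀ ⦃u a b⦄, G.Adj u a → G.Adj u b → h a < h u → h b < h u → a = b

theorem HasCliqueBranches.exists_isHeight [Finite V] (hG : G.HasCliqueBranches) :
    ∃ h : V → ℕ, G.IsHeight h := by
  classical
  have := Fintype.ofFinite V
  let root : V → V := fun u => (G.connectedComponentMk u).out
  have hreach : ∀ u, G.Reachable u (root u) := fun u =>
    ConnectedComponent.exact (Quot.out_eq (G.connectedComponentMk u)).symm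
  have hroot : ∀ u w, G.Adj u w → root u = root w := fun u w h => by
    simp only [root, ConnectedComponent.connectedComponentMk_eq_of_adj h]
  let h : V → ℕ := fun u => G.dist u (root u)
  have hle : ∀ u w, G.Adj u w → h w ≤ h u + 1 := by
    intro u w huw
    obtain ⟨p, hp⟩ := (hreach u).exists_walk_length_eq_dist
    have := dist_le (Walk.cons huw.symm p)
    rw [Walk.length_cons, hp, hroot u w huw] at this
    simpa only [h, hroot u w huw] using this
  have hpar : ∀ u, h u ≠ 0 → ∃ w, G.Adj u w ∧ h w < h u := by
    intro u hu
    obtain ⟨p, hp⟩ := (hreach u).exists_walk_length_eq_dist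
    generalize hr : root u = r at p hp
    cases p with
    | nil =>
      simp only [h, hr, SimpleGraph.dist_self] at hu
      exact absurd rfl hu
    | @cons _ w _ huw q =>
      refine ⟨w, huw, ?_⟩
      have h1 := dist_le q
      rw [Walk.length_cons] at hp
      simp only [h, ← hroot u w huw, hr]
      omega
  have hzero : ∀ u, h u = 0 → u = root u := fun u hu => (hreach u).dist_eq_zero_iff.1 hu
  -- From a vertex `w ≠ u` not above `u`, a descending path to the root stays strictly below `u`
  -- after its start, so it avoids `u`.
  have hconn : ∀ u, h u ≠ 0 →
      G.IsConnSet (Finset.univ.filter fun w => w ≠ u ∧ h w ≤ h u ∧ root w = root u) := by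
    intro u hu
    have hr0 : ∀ w, h w = 0 → root w = root u → w = root u := fun w hw hw' => by
      rw [← hw']
      exact hzero w hw
    have hrr : root (root u) = root u :=
      congrArg Quot.out (ConnectedComponent.sound (hreach u).symm)
    have hh0 : h (root u) = 0 := by
      simp only [h, hrr, SimpleGraph.dist_self]
    refine isConnSet_of_forall_mem (t := root u) ?_ fun P hP hPr hcl => ?_
    · refine Finset.mem_filter.2 ⟨Finset.mem_univ _, fun he => hu ?_, by omega, hrr⟩
      rw [← he, hh0]
    · intro w hw
      induction hn : h w using Nat.strong_induction_on generalizing w with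
      | _ n ih =>
      obtain ⟨-, hwu, hwh, hwr⟩ := Finset.mem_filter.1 hw
      by_cases h0 : h w = 0
      · exact hr0 w h0 hwr ▸ hPr
      obtain ⟨z, hz, hzw⟩ := hpar w h0
      have hzm : z ∈ Finset.univ.filter fun w => w ≠ u ∧ h w ≤ h u ∧ root w = root u := by
        refine Finset.mem_filter.2 ⟨Finset.mem_univ _, ?_, by omega, ?_⟩
        · rintro rfl
          omega
        · rw [← hroot w z hz, hwr]
      exact hcl z (ih (h z) (by omega) hzm rfl) w hw hz.symm
  have hadj : ∀ u a b, G.Adj u a → G.Adj u b → a ≠ b → h a ≤ h u → h b ≤ h u → G.Adj a b := by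
    intro u a b ha hb hne hau hbu
    by_cases hu : h u = 0
    · exact absurd ((hzero a (by omega)).trans (((hroot u a ha).symm.trans (hroot u b hb)).trans
        (hzero b (by omega)).symm)) hne
    · refine hG _ ha hb hne (hconn u hu) ?_ ?_ (by simp)
      · simp [ha.ne', hau, (hroot u a ha).symm]
      · simp [hb.ne', hbu, (hroot u b hb).symm]
  refine ⟨h, hle, hadj, ?_⟩
  intro u a b ha hb hau hbu
  by_contra hne
  have hab := hadj u a b ha hb hne hau.le hbu.le
  have h1 := hle a u ha.symm
  have h2 := hle b u hb.symm
  -- Here `a` and `b` are adjacent and both one level below `u`. If they are not the root, a parent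
  -- `z` of `a` is adjacent to `b`, hence to `u`, although it is two levels below `u`.
  by_cases h0 : h a = 0
  · exact hne ((hzero a h0).trans (((hroot u a ha).symm.trans (hroot u b hb)).trans
        (hzero b (by omega)).symm))
  obtain ⟨z, hz, hza⟩ := hpar a h0
  have hzb : G.Adj z b := hadj a z b hz hab (by rintro rfl; omega) hza.le (by omega)
  have hzu : z ≠ u := by
    rintro rfl
    omega
  have : G.Adj z u := by
    refine hG {a, z, u} hzb.symm hb.symm hzu ?_ (by simp) (by simp) ?_
    · have := ((isConnSet_singleton (G := G) a).insert (by simp) hz).insert (a := a) (by simp) ha.symm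
      convert this using 1
      ext; simp; tauto
    · simp only [Finset.mem_insert, Finset.mem_singleton, not_or]
      exact ⟨Ne.symm hne, hzb.ne', hb.ne'⟩
  have := hle z u this
  omega

/-! ### Arms and induced copies of `T₃` -/

/-- `t, e, f` is an induced path that leaves the clique containing the adjacent vertices `t` and
`s`. -/
structure IsArm (G : SimpleGraph V) (t s e f : V) : Prop where
  adj : G.Adj t e
  ne : e ≠ s
  not_adj : ¬ G.Adj e s
  adj' : G.Adj e f
  ne' : f ≠ t
  not_adj' : ¬ G.Adj f t

section

variable [DecidableEq V]

theorem isConnSet_pair {a b : V} (hab : G.Adj a b) : G.IsConnSet {a, b} := by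
  rw [Finset.pair_comm]
  exact (isConnSet_singleton a).insert (by simp) hab

/-- The vertex in the middle of a path of length two is listed first. -/
theorem isConnSet_triple {a b c : V} (hab : G.Adj a b) (hac : G.Adj a c) :
    G.IsConnSet {b, a, c} :=
  (isConnSet_pair hac).insert (by simp) hab

theorem HasCliqueBranches.diamond (hG : G.HasCliqueBranches) {u a b c : V} (ha : G.Adj u a)
    (hb : G.Adj u b) (hc : G.Adj u c) (hab : G.Adj a b) (hac : G.Adj a c) (hne : b ≠ c) :
    G.Adj b c := by
  refine hG {b, a, c} hb hc hne (isConnSet_triple hab hac) (by simp) (by simp) ?_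
  simp [hb.ne, ha.ne, hc.ne]

theorem IsArm.of_triangle (hG : G.HasCliqueBranches) {t s s' e f : V} (h : G.IsArm t s e f)
    (hs : G.Adj t s) (hs' : G.Adj t s') (hss' : G.Adj s s') : G.IsArm t s' e f where
  adj := h.adj
  ne := by
    rintro rfl
    exact h.not_adj hss'.symm
  not_adj := fun he => h.not_adj (hG.diamond hs' h.adj hs he.symm hss'.symm h.ne)
  adj' := h.adj'
  ne' := h.ne'
  not_adj' := h.not_adj'

/-- An edge from `T` to `e` or `f` would join `s` to `e` by a connected set avoiding `t`, forcing
the excluded edge `es`. -/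
theorem IsArm.not_adj_of_isConnSet (hG : G.HasCliqueBranches) {t s e f : V} (h : G.IsArm t s e f)
    (hs : G.Adj t s) {T : Finset V} (hT : G.IsConnSet T) (hsT : s ∈ T) (htT : t ∉ T) :
    ∀ x ∈ T, ¬ G.Adj e x ∧ ¬ G.Adj f x := by
  have he : ∀ T, G.IsConnSet T → s ∈ T → t ∉ T → e ∉ T := fun T hT hsT htT heT =>
    h.not_adj (hG T h.adj hs h.ne hT heT hsT htT)
  have he' : ∀ T, G.IsConnSet T → s ∈ T → t ∉ T → ∀ x ∈ T, ¬ G.Adj e x :=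
    fun T hT hsT htT x hx hex => he (insert e T) (hT.insert hx hex.symm)
      (Finset.mem_insert_of_mem hsT) (by simp [htT, h.adj.ne]) (Finset.mem_insert_self _ _)
  refine fun x hx => ⟨he' T hT hsT htT x hx, fun hfx => ?_⟩
  exact he' (insert f T) (hT.insert hx hfx.symm) (Finset.mem_insert_of_mem hsT)
      (by simp [htT, h.ne'.symm]) f (Finset.mem_insert_self _ _) h.adj'

theorem IsArm.not_adj_isArm (hG : G.HasCliqueBranches) {t s e f e' f' : V} (h : G.IsArm t s e f)
    (h' : G.IsArm s t e' f') (hs : G.Adj t s) :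
    (¬ G.Adj e s ∧ ¬ G.Adj e e' ∧ ¬ G.Adj e f') ∧ (¬ G.Adj f s ∧ ¬ G.Adj f e' ∧ ¬ G.Adj f f') := by
  have hT : G.IsConnSet {s, e', f'} := isConnSet_triple h'.adj.symm h'.adj'
  have ht : t ∉ ({s, e', f'} : Finset V) := by
    simp only [Finset.mem_insert, Finset.mem_singleton, not_or]
    refine ⟨hs.ne, h'.ne.symm, ?_⟩
    rintro rfl
    exact h'.not_adj' hs
  have key := h.not_adj_of_isConnSet hG hs hT (by simp) ht
  have h1 := key s (by simp)
  have h2 := key e' (by simp)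
  have h3 := key f' (by simp)
  exact ⟨⟨h1.1, h2.1, h3.1⟩, h1.2, h2.2, h3.2⟩

/-- Arms at different vertices of the triangle lie in different branches, so there are no edges
between them, nor from an arm to another vertex of the triangle. -/
theorem isIndContained_graphT3_of_isArm (hG : G.HasCliqueBranches) {a b c e₁ f₁ e₂ f₂ e₃ f₃ : V}
    (hab : G.Adj a b) (hac : G.Adj a c) (hbc : G.Adj b c) (h₁ : G.IsArm a b e₁ f₁)
    (h₂ : G.IsArm b a e₂ f₂) (h₃ : G.IsArm c a e₃ f₃) : graphT3.IsIndContained G := by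
  have h₁' := h₁.of_triangle hG hab hac hbc
  have h₂' := h₂.of_triangle hG hab.symm hbc hac
  have h₃' := h₃.of_triangle hG hac.symm hbc.symm hab
  obtain ⟨⟨p1, p2, p3⟩, p4, p5, p6⟩ := h₁.not_adj_isArm hG h₂ hab
  obtain ⟨⟨q1, q2, q3⟩, q4, q5, q6⟩ := h₁'.not_adj_isArm hG h₃ hac
  obtain ⟨⟨r1, r2, r3⟩, r4, r5, r6⟩ := h₂'.not_adj_isArm hG h₃' hbc
  obtain ⟨⟨p1', -, -⟩, p4', -, -⟩ := h₂.not_adj_isArm hG h₁ hab.symm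
  obtain ⟨⟨q1', -, -⟩, q4', -, -⟩ := h₃.not_adj_isArm hG h₁' hac.symm
  obtain ⟨⟨r1', -, -⟩, r4', -, -⟩ := h₃'.not_adj_isArm hG h₂' hbc.symm
  let F : Fin 9 → V := ![f₁, e₁, a, b, c, e₃, f₃, e₂, f₂]
  have hadj : ∀ i j, i < j → (G.Adj (F i) (F j) ↔ graphT3.Adj i j) := by
    intro i j hij
    fin_cases i <;> fin_cases j <;> first
      | exact absurd hij (by decide)
      | simp [F, graphT3, hab, hac, hbc, h₂.adj, h₃.adj, h₂.adj', h₃.adj',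
          h₁.adj'.symm, h₁.adj.symm, h₁.not_adj', h₂.not_adj', h₃.not_adj', G.adj_comm a f₂,
          G.adj_comm a e₂, G.adj_comm a e₃, G.adj_comm a f₃, G.adj_comm b f₂, G.adj_comm c f₃,
          G.adj_comm b e₃, G.adj_comm b f₃, G.adj_comm c e₂, G.adj_comm c f₂, G.adj_comm e₃ e₂,
          G.adj_comm e₃ f₂, G.adj_comm f₃ e₂, G.adj_comm f₃ f₂,
          p1, p2, p3, p4, p5, p6, q1, q2, q3, q4, q5, q6, r1, r2, r3, r4, r5, r6,
          p1', p4', q1', q4', r1', r4']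
  have hadj' : ∀ i j, G.Adj (F i) (F j) ↔ graphT3.Adj i j := by
    intro i j
    rcases lt_trichotomy i j with h | rfl | h
    · exact hadj i j h
    · simp
    · rw [G.adj_comm, graphT3.adj_comm]
      exact hadj j i h
  -- Vertices of `T₃` are determined by their neighbourhoods, so injectivity of `F` follows from its
  -- preserving and reflecting adjacency.
  have hT3 : ∀ i j : Fin 9, (∀ k, graphT3.Adj i k ↔ graphT3.Adj j k) → i = j := by
    have hdec : ∀ i j : Fin 9, graphT3.Adj i j ↔ s(i, j) ∈ ({s(0, 1), s(1, 2), s(2, 3), s(2, 4),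
        s(3, 4), s(4, 5), s(5, 6), s(3, 7), s(7, 8)} : Finset (Sym2 (Fin 9))) ∧ i ≠ j := by
      intro i j
      simp [graphT3]
    simp only [hdec]
    decide
  refine ⟨⟨⟨F, fun i j hij => hT3 i j fun k => ?_⟩, hadj' _ _⟩⟩
  rw [← hadj', ← hadj', hij]

end

end SimpleGraph

/-! ### Vertices with a clique link -/

open PreAbstractSimplicialComplex

namespace SimpleGraph

section

variable {V : Type*} {G : SimpleGraph V} [DecidableEq V]

/-- Three connected vertices of a `3`-independent set form a component of it. -/
theorem IsRIndepSet.mem_of_adj {A T : Finset V} (hA : G.IsRIndepSet 3 A) (hTA : T ⊆ A)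
    (hT : G.IsConnSet T) (hcard : T.card = 3) {a b : V} (ha : a ∈ T) (hb : b ∈ A)
    (hab : G.Adj a b) : b ∈ T := by
  by_contra hbT
  have := isRIndepSet_iff.1 hA _ (Finset.insert_subset hb hTA) (hT.insert ha hab)
  rw [Finset.card_insert_of_notMem hbT] at this
  omega

theorem not_isRIndepSet_of_adj {A T : Finset V} (hTA : T ⊆ A)
    (hT : G.IsConnSet T) (hcard : T.card = 3) {a b : V} (ha : a ∈ T) (hb : b ∈ A)
    (hab : G.Adj a b) (hbT : b ∉ T) : ¬ G.IsRIndepSet 3 A :=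
  fun hA => hbT (hA.mem_of_adj hTA hT hcard ha hb hab)

/-- Adding a vertex `v` whose component `P` is small preserves independence. -/
theorem IsRIndepSet.of_closed {r : ℕ} {A B P : Finset V} (hA : G.IsRIndepSet r A)
    (hP : P.card ≤ r) {v : V} (hv : v ∈ P) (hBA : ∀ x ∈ B, x ≠ v → x ∈ A)
    (hcl : ∀ a ∈ P, ∀ b ∈ B, G.Adj a b → b ∈ P) : G.IsRIndepSet r B := by
  refine isRIndepSet_iff.2 fun T hTB hT => ?_
  by_cases hvT : v ∈ T
  · exact (Finset.card_le_card (hT.subset_of_closed hvT hv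
      fun a ha b hb => hcl a ha b (hTB hb))).trans hP
  · exact isRIndepSet_iff.1 hA T
      (fun x hx => hBA x (hTB hx) fun h => hvT (h ▸ hx)) hT

/-- The neighbours of `v` among the vertices that can be added to `S` are pairwise adjacent. -/
def HasCliqueLink (G : SimpleGraph V) (S : Finset V) (v : V) : Prop :=
  ∀ a b, G.IsRIndepSet 3 (insert a S) → G.IsRIndepSet 3 (insert b S) → G.Adj v a → G.Adj v b →
    a ≠ b → G.Adj a b

theorem IsRIndepSet.insert_of_mem {A S : Finset V} (hA : G.IsRIndepSet 3 A) (hSA : S ⊆ A) {a : V}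
    (ha : a ∈ A) : G.IsRIndepSet 3 (insert a S) :=
  hA.mono (Finset.insert_subset ha hSA)

/-- A route through `v` can be shortcut along the edge between its two neighbours of `v`. -/
theorem IsConnSet.erase {K : Finset V} (hK : G.IsConnSet K) {v : V}
    (h : ∀ a ∈ K, ∀ b ∈ K, G.Adj v a → G.Adj v b → a ≠ b → G.Adj a b) :
    G.IsConnSet (K.erase v) := by
  by_cases hvK : v ∈ K
  swap
  · rwa [Finset.erase_eq_of_notMem hvK]
  intro X hX hne hXK
  by_contra! hcut
  have hXK' : X ⊆ K := hX.trans (Finset.erase_subset _ _)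
  have hvX : v ∉ X := fun h => Finset.notMem_erase v K (hX h)
  by_cases hex : ∃ a₀ ∈ X, G.Adj v a₀
  · obtain ⟨a₀, ha₀, hva₀⟩ := hex
    obtain ⟨a, ha, b, hb, hbX, hab⟩ := hK (insert v X) (Finset.insert_subset hvK hXK')
      (Finset.insert_nonempty v X) fun he => hXK (by rw [← he, Finset.erase_insert hvX])
    rw [Finset.mem_insert, not_or] at hbX
    have hbe : b ∈ K.erase v := Finset.mem_erase.2 ⟨hbX.1, hb⟩
    rcases Finset.mem_insert.1 ha with rfl | ha
    · exact hcut a₀ ha₀ b hbe hbX.2 (h a₀ (hXK' ha₀) b hb hva₀ hab fun he => hbX.2 (he ▸ ha₀))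
    · exact hcut a ha b hbe hbX.2 hab
  · push Not at hex
    obtain ⟨a, ha, b, hb, hbX, hab⟩ := hK X hXK' hne fun he => hvX (he ▸ hvK)
    by_cases hbv : b = v
    · exact hex a ha (hbv ▸ hab.symm)
    · exact hcut a ha b (Finset.mem_erase.2 ⟨hbv, hb⟩) hbX hab

/-- The component `K` of `v` in `insert v A` stays connected without `v`, so it has exactly four
vertices. Deleting any one of them other than `v` repairs independence, and the obstruction is `K`
without `v` and `S`. -/
theorem HasCliqueLink.isLinkSimplicial {S : Finset V} {v : V} (h : G.HasCliqueLink S v) :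
    IsLinkSimplicial (G.IsRIndepSet 3) S v := by
  intro A hSA hA hvA hvA'
  obtain ⟨K, hKA, hvK, hK, hcl⟩ := exists_component (G := G) (Finset.mem_insert_self v A)
  have hmem : ∀ x ∈ K, x ≠ v → x ∈ A := fun x hx hxv =>
    (Finset.mem_insert.1 (hKA hx)).resolve_left hxv
  have hcard : (K.erase v).card ≤ 3 := by
    refine isRIndepSet_iff.1 hA _ (fun x hx => ?_) (hK.erase fun a ha b hb hva hvb hab => ?_)
    · rw [Finset.mem_erase] at hx
      exact hmem x hx.2 hx.1
    · exact h a b (hA.insert_of_mem hSA (hmem a ha hva.ne'))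
        (hA.insert_of_mem hSA (hmem b hb hvb.ne')) hva hvb hab
  have hle : ¬ K.card ≤ 3 := fun hle =>
    hvA' (hA.of_closed hle hvK (fun x hx hxv => (Finset.mem_insert.1 hx).resolve_left hxv) hcl)
  rw [Finset.card_erase_of_mem hvK] at hcard
  refine ⟨(K.erase v) \ S, ?_, ?_, ?_⟩
  · intro x hx
    rw [Finset.mem_sdiff, Finset.mem_erase] at hx
    exact Finset.mem_sdiff.2 ⟨hmem x hx.1.2 hx.1.1, hx.2⟩
  · intro hI
    refine hle (isRIndepSet_iff.1 hI K (fun x hx => ?_) hK)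
    simp only [Finset.mem_insert, Finset.mem_union, Finset.mem_sdiff, Finset.mem_erase]
    tauto
  · intro w hw
    rw [Finset.mem_sdiff, Finset.mem_erase] at hw
    refine hA.of_closed (P := K.erase w) ?_ (Finset.mem_erase.2 ⟨hw.1.1.symm, hvK⟩) ?_ ?_
    · rw [Finset.card_erase_of_mem hw.1.2]
      omega
    · intro x hx hxv
      exact (Finset.mem_insert.1 (Finset.mem_of_mem_erase hx)).resolve_left hxv
    · intro a ha b hb hab
      rw [Finset.mem_erase] at ha hb ⊢
      exact ⟨hb.1, hcl a ha.2 b hb.2 hab⟩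

/-- If every addable neighbour of `b` were `p` or adjacent to `p`, the diamond property would make
these neighbours a clique. -/
theorem exists_adj_of_not_hasCliqueLink (hG : G.HasCliqueBranches) {S : Finset V} {b p : V}
    (hbp : G.Adj b p) (hb : ¬ G.HasCliqueLink S b) :
    ∃ e, G.IsRIndepSet 3 (insert e S) ∧ G.Adj b e ∧ e ≠ p ∧ ¬ G.Adj e p := by
  by_contra! hcon
  refine hb fun a a' ha ha' hba hba' hne => ?_
  by_cases h1 : a = p
  · subst h1
    exact (hcon a' ha' hba' hne.symm).symm
  by_cases h2 : a' = p
  · subst h2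
    exact hcon a ha hba hne
  exact hG.diamond hbp hba hba' (hcon a ha hba h1).symm (hcon a' ha' hba' h2).symm hne

/-- If no vertex that can be added to `S` has a clique link, then a triangle which is a component of
an independent set `A ⊇ S` has an arm at each vertex outside `S`. -/
theorem exists_isArm (hG : G.HasCliqueBranches) {S A : Finset V}
    (hN : ∀ v, v ∉ S → G.IsRIndepSet 3 (insert v S) → ¬ G.HasCliqueLink S v) (hSA : S ⊆ A)
    (hA : G.IsRIndepSet 3 A) {b p c : V} (hb : b ∈ A) (hp : p ∈ A) (hc : c ∈ A) (hbS : b ∉ S)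
    (hbp : G.Adj b p) (hbc : G.Adj b c) (hpc : G.Adj p c) : ∃ e f, G.IsArm b p e f := by
  obtain ⟨e, he, hbe, hep, hep'⟩ := exists_adj_of_not_hasCliqueLink hG hbp
    (hN b hbS (hA.insert_of_mem hSA hb))
  -- The triangle is already a full component of `A`, so a neighbour of `b` in `S` would belong to
  -- it. Hence `e` is a new vertex, and the failure of the clique property at `e` supplies `f`.
  have heS : e ∉ S := by
    intro heS
    have hcard : ({p, b, c} : Finset V).card = 3 :=
      Finset.card_eq_three.2 ⟨p, b, c, hbp.ne', hpc.ne, hbc.ne, rfl⟩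
    have := hA.mem_of_adj (T := {p, b, c}) (by simp [Finset.insert_subset_iff, *])
      (isConnSet_triple hbp hbc) hcard (by simp) (hSA heS) hbe
    simp only [Finset.mem_insert, Finset.mem_singleton] at this
    rcases this with rfl | rfl | rfl
    · exact hep rfl
    · exact hbe.ne rfl
    · exact hep' hpc.symm
  obtain ⟨f, -, hef, hfb, hfb'⟩ := exists_adj_of_not_hasCliqueLink hG hbe.symm (hN e heS he)
  exact ⟨e, f, hbe, hep, hep', hef, hfb, hfb'⟩

/-! ### Simplicial vertices on the top level -/

/-- The situation around the highest vertices that can be added to `S`: such a vertex `w` has a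
neighbour in `S` above it, and independent sets containing `S` have no triangle with an arm and
two vertices outside `S`. -/
structure IsTopLevel (G : SimpleGraph V) (h : V → ℕ) (S : Finset V) (d : ℕ) : Prop where
  isHeight : G.IsHeight h
  le : ∀ w, w ∉ S → G.IsRIndepSet 3 (insert w S) → h w ≤ d
  exists_child : ∀ w, w ∉ S → G.IsRIndepSet 3 (insert w S) → h w = d →
    ∃ x ∈ S, G.Adj w x ∧ h x = d + 1
  not_isArm : ∀ A p b c v x, S ⊆ A → G.IsRIndepSet 3 A → p ∈ A → b ∈ A → c ∈ A → G.Adj p b →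
    G.Adj p c → G.Adj b c → b ∉ S → c ∉ S → ¬ G.IsArm p b v x

variable {h : V → ℕ} {S : Finset V} {d : ℕ}

theorem IsTopLevel.isArm (H : G.IsTopLevel h S d) {p b v x : V} (hpv : G.Adj p v)
    (hvx : G.Adj v x) (hp : h p < h v) (hb : h b ≤ h p) (hbp : b ≠ p) (hx : h x = h v + 1) :
    G.IsArm p b v x where
  adj := hpv
  ne := by
    rintro rfl
    omega
  not_adj := fun hvb => hbp (H.isHeight.unique hvb hpv.symm (by omega) hp)
  adj' := hvx
  ne' := by
    rintro rfl
    omega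
  not_adj' := fun hxp => by
    have := H.isHeight.le_succ hxp.symm
    have := H.isHeight.le_succ hpv
    omega

theorem card_triple {a b c : V} (hab : a ≠ b) (hac : a ≠ c) (hbc : b ≠ c) :
    ({a, b, c} : Finset V).card = 3 :=
  Finset.card_eq_three.2 ⟨a, b, c, hab, hac, hbc, rfl⟩

/-- Here `{v, x}` is the component of `v` in `insert v S`, and `x` gains no neighbour in `A`. The
obstruction consists of one neighbour of `v`, or of a neighbour `p` below `v` with its only
neighbour `b` in `A`. -/
theorem IsTopLevel.isLinkSimplicial_of_pair (H : G.IsTopLevel h S d) {v x : V} (hvS : v ∉ S)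
    (hv : G.IsRIndepSet 3 (insert v S)) (hvd : h v = d) (hxS : x ∈ S) (hvx : G.Adj v x)
    (hxd : h x = d + 1) (hcl : ∀ y ∈ S, G.Adj v y ∨ G.Adj x y → y = x) :
    IsLinkSimplicial (G.IsRIndepSet 3) S v := by
  intro A hSA hA hvA hvA'
  have hh := H.isHeight
  have hxA := hSA hxS
  have hle : ∀ u ∈ A, u ∉ S → h u ≤ d := fun u hu huS => H.le u huS (hA.insert_of_mem hSA hu)
  have hxv : ∀ y ∈ A, ¬ G.Adj x y := by
    intro y hy hxy
    by_cases hyS : y ∈ S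
    · exact hxy.ne (hcl y hyS (Or.inr hxy)).symm
    · have := hle y hy hyS
      exact hvA (hh.unique hvx.symm hxy (by omega) (by omega) ▸ hy)
  have hnS : ∀ y ∈ A, G.Adj v y → y ≠ x → y ∉ S := fun y hy hvy hne hyS =>
    hne (hcl y hyS (Or.inl hvy))
  have herase : ∀ w, ∀ y ∈ (insert v A).erase w, y ≠ v → y ∈ A := fun w y hy hyv =>
    (Finset.mem_insert.1 (Finset.mem_of_mem_erase hy)).resolve_left hyv
  have hpair : ∀ B : Finset V, (∀ y ∈ B, y ≠ v → y ∈ A) → (∀ y ∈ B, G.Adj v y → y = x) →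
      G.IsRIndepSet 3 B := by
    intro B hB hB'
    refine hA.of_closed (P := {v, x}) (Finset.card_le_two.trans (by norm_num))
      (Finset.mem_insert_self _ _) hB fun a ha b hb hab => ?_
    by_cases hbv : b = v
    · simp [hbv]
    rw [Finset.mem_insert, Finset.mem_singleton] at ha
    rcases ha with rfl | rfl
    · simp [hB' b hb hab]
    · exact absurd hab (hxv b (hB b hb hbv))
  have htriple : ∀ (B : Finset V) (p : V), (∀ y ∈ B, y ≠ v → y ∈ A) →
      (∀ y ∈ B, G.Adj v y → y = x ∨ y = p) → (∀ y ∈ B, G.Adj p y → y = v) →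
      G.IsRIndepSet 3 B := by
    intro B p hB hB' hB''
    refine hA.of_closed (P := {v, x, p}) Finset.card_le_three
      (Finset.mem_insert_self _ _) hB fun a ha b hb hab => ?_
    by_cases hbv : b = v
    · simp [hbv]
    simp only [Finset.mem_insert, Finset.mem_singleton] at ha ⊢
    rcases ha with rfl | rfl | rfl
    · exact Or.inr (hB' b hb hab)
    · exact absurd hab (hxv b (hB b hb hbv))
    · exact absurd (hB'' b hb hab) hbv
  -- A top-level neighbour `u` has its own child `z ∈ S`, so `x, v, u, z` is an obstruction. Any
  -- other neighbour `u'` of `v` in `A` besides `x` fills the component `{z, u, u'}` of `A`, so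
  -- without `u` the component of `v` has at most three vertices.
  by_cases hα : ∃ u ∈ A, G.Adj v u ∧ u ≠ x ∧ h u = d
  · obtain ⟨u, hu, hvu, hux, hud⟩ := hα
    have huS := hnS u hu hvu hux
    obtain ⟨z, hzS, huz, hzd⟩ := H.exists_child u huS (hA.insert_of_mem hSA hu) hud
    have hzx : z ≠ x := by
      rintro rfl
      exact hxv u hu huz.symm
    have hzA := hSA hzS
    refine ⟨{u}, by simpa using ⟨hu, huS⟩, ?_, ?_⟩
    · refine not_isRIndepSet_of_adj (T := {x, v, u}) (b := z) (a := u) ?_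
        (isConnSet_triple hvx hvu) (card_triple hvx.ne' (Ne.symm hux) hvu.ne) (by simp)
        (by simp [hzS]) huz ?_
      · simp [Finset.insert_subset_iff, hxS]
      · simp only [Finset.mem_insert, Finset.mem_singleton, not_or]
        refine ⟨hzx, ?_, huz.ne'⟩
        rintro rfl
        omega
    · intro w hw
      rw [Finset.mem_singleton] at hw
      subst hw
      by_cases hex : ∃ u' ∈ A, G.Adj v u' ∧ u' ≠ x ∧ u' ≠ w
      · obtain ⟨u', hu', hvu', hux', hne⟩ := hex
        have huS' := hnS u' hu' hvu' hux'
        have hd' := hle u' hu' huS'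
        have huu' : G.Adj w u' := hh.adj hvu hvu' hne.symm (by omega) (by omega)
        have hzu' : z ≠ u' := fun he => huS' (he ▸ hzS)
        have hC : ∀ a ∈ ({z, w, u'} : Finset V), ∀ b ∈ A, G.Adj a b →
            b ∈ ({z, w, u'} : Finset V) := fun a ha b hb hab =>
          hA.mem_of_adj (by simp [Finset.insert_subset_iff, hu, hu', hzA])
            (isConnSet_triple huz huu') (card_triple huz.ne' hzu' huu'.ne) ha hb hab
        refine htriple _ u' (herase w) ?_ ?_
        · intro y hy hvy
          by_contra! hcon
          have hyA := herase w y hy hvy.ne'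
          have hyS := hnS y hyA hvy hcon.1
          have hyw := Finset.ne_of_mem_erase hy
          have := hle y hyA hyS
          have hwy : G.Adj w y := hh.adj hvu hvy hyw.symm (by omega) (by omega)
          have := hC w (by simp) y hyA hwy
          simp only [Finset.mem_insert, Finset.mem_singleton] at this
          rcases this with rfl | rfl | rfl
          · exact hyS hzS
          · exact hyw rfl
          · exact hcon.2 rfl
        · intro y hy hy'
          by_contra hyv
          have hyA := herase w y hy hyv
          have hyw := Finset.ne_of_mem_erase hy
          have := hC u' (by simp) y hyA hy'
          simp only [Finset.mem_insert, Finset.mem_singleton] at this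
          rcases this with rfl | rfl | rfl
          · exact hne (hh.unique hy'.symm huz.symm (by omega) (by omega))
          · exact hyw rfl
          · exact hy'.ne rfl
      · push Not at hex
        refine hpair _ (herase w) fun y hy hvy => ?_
        by_contra hyx
        exact Finset.ne_of_mem_erase hy (hex y (herase w y hy hvy.ne') hvy hyx)
  push Not at hα
  have hins : ∀ y ∈ insert v A, y ≠ v → y ∈ A := fun y hy hyv =>
    (Finset.mem_insert.1 hy).resolve_left hyv
  obtain ⟨p, hpA, hvp, hpx⟩ : ∃ p ∈ A, G.Adj v p ∧ p ≠ x := by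
    by_contra! hcon
    exact hvA' (hpair _ hins fun y hy hvy => hcon y (hins y hy hvy.ne') hvy)
  have hpS := hnS p hpA hvp hpx
  have hlt : ∀ y ∈ A, G.Adj v y → y ≠ x → h y < d := fun y hy hvy hyx =>
    lt_of_le_of_ne (hle y hy (hnS y hy hvy hyx)) (hα y hy hvy hyx)
  have hpd := hlt p hpA hvp hpx
  have hpd' := hh.le_succ hvp.symm
  have hvp_unique : ∀ y ∈ A, G.Adj v y → y = x ∨ y = p := by
    intro y hy hvy
    by_contra! hcon
    have := hlt y hy hvy hcon.1
    exact hcon.2 (hh.unique hvy hvp (by omega) (by omega))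
  have hnot : ∀ b ∈ A, G.Adj p b → ∀ B : Finset V, v ∈ B → x ∈ B → p ∈ B → b ∈ B →
      ¬ G.IsRIndepSet 3 B := by
    intro b hb hpb B hvB hxB hpB hbB
    refine not_isRIndepSet_of_adj (T := {x, v, p}) (a := p) (b := b) ?_ (isConnSet_triple hvx hvp)
      (card_triple hvx.ne' (Ne.symm hpx) hvp.ne) (by simp) hbB hpb ?_
    · simp [Finset.insert_subset_iff, hvB, hxB, hpB]
    · simp only [Finset.mem_insert, Finset.mem_singleton, not_or]
      refine ⟨?_, fun he => hvA (he ▸ hb), hpb.ne'⟩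
      rintro rfl
      exact hxv p hpA hpb.symm
  have herase_p : G.IsRIndepSet 3 ((insert v A).erase p) :=
    hpair _ (herase p) fun y hy hvy =>
      (hvp_unique y (herase p y hy hvy.ne') hvy).resolve_right (Finset.ne_of_mem_erase hy)
  by_cases hb : ∃ b ∈ A, G.Adj p b
  swap
  · push Not at hb
    refine absurd (htriple _ p hins (fun y hy hvy => hvp_unique y (hins y hy hvy.ne') hvy) ?_) hvA'
    intro y hy hpy
    by_contra hyv
    exact hb y (hins y hy hyv) hpy
  by_cases hbS : ∃ b ∈ S, G.Adj p b
  · obtain ⟨b, hbS, hpb⟩ := hbS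
    refine ⟨{p}, by simpa using ⟨hpA, hpS⟩, hnot b (hSA hbS) hpb _ (by simp) (by simp [hxS])
      (by simp) (by simp [hbS]), ?_⟩
    intro w hw
    rw [Finset.mem_singleton] at hw
    exact hw ▸ herase_p
  push Not at hbS
  obtain ⟨b, hbA, hpb⟩ := hb
  have hbS' : b ∉ S := fun hb => hbS b hb hpb
  -- Two neighbours `b, c` of `p` fill its component, which is disjoint from `S`; so neither has a
  -- child in `S` and both are below the top level. They are then adjacent, and the triangle `p, b,
  -- c` has the forbidden arm `v, x` at `p`.
  have hb_unique : ∀ c ∈ A, G.Adj p c → c = b := by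
    intro c hcA hpc
    by_contra hcb
    have hcS' : c ∉ S := fun hc => hbS c hc hpc
    have hC : ∀ a ∈ ({b, p, c} : Finset V), ∀ z ∈ A, G.Adj a z → z ∈ ({b, p, c} : Finset V) :=
      fun a ha z hz haz => hA.mem_of_adj (by simp [Finset.insert_subset_iff, hbA, hpA, hcA])
        (isConnSet_triple hpb hpc) (card_triple hpb.ne' (Ne.symm hcb) hpc.ne) ha hz haz
    have hlow : ∀ z ∈ A, z ∈ ({b, p, c} : Finset V) → z ∉ S → h z < d := by
      intro z hzA hz hzS
      refine lt_of_le_of_ne (hle z hzA hzS) fun hzd => ?_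
      obtain ⟨y, hyS, hzy, -⟩ := H.exists_child z hzS (hA.insert_of_mem hSA hzA) hzd
      have := hC z hz y (hSA hyS) hzy
      simp only [Finset.mem_insert, Finset.mem_singleton] at this
      rcases this with rfl | rfl | rfl
      · exact hbS' hyS
      · exact hpS hyS
      · exact hcS' hyS
    have h1 := hlow b hbA (by simp) hbS'
    have h2 := hlow c hcA (by simp) hcS'
    have hbc : G.Adj b c := hh.adj hpb hpc (Ne.symm hcb) (by omega) (by omega)
    exact H.not_isArm A p b c v x hSA hA hpA hbA hcA hpb hpc hbc hbS' hcS'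
      (H.isArm hvp.symm hvx (by omega) (by omega) hpb.ne' (by omega))
  refine ⟨{p, b}, ?_, hnot b hbA hpb _ (by simp) (by simp [hxS]) (by simp) (by simp), ?_⟩
  · simp [Finset.insert_subset_iff, hpA, hpS, hbA, hbS']
  · intro w hw
    rw [Finset.mem_insert, Finset.mem_singleton] at hw
    rcases hw with rfl | rfl
    · exact herase_p
    · refine htriple _ p (herase w)
        (fun y hy hvy => hvp_unique y (herase w y hy hvy.ne') hvy) fun y hy hpy => ?_
      by_contra hyv
      exact Finset.ne_of_mem_erase hy (hb_unique y (herase w y hy hyv) hpy)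

/-- The vertex `v` has a component of order three in `G[S ∪ {v}]`, and so has each vertex of the
same height that can be added to `S`. -/
theorem IsTopLevel.isLinkSimplicial_of_triple (H : G.IsTopLevel h S d)
    (hM : ∀ w, w ∉ S → G.IsRIndepSet 3 (insert w S) → h w = d →
      ∀ x ∈ S, G.Adj w x → h x = d + 1 → ∃ y ∈ S, (G.Adj w y ∨ G.Adj x y) ∧ y ≠ x)
    {v : V} (hvS : v ∉ S) (hv : G.IsRIndepSet 3 (insert v S)) (hvd : h v = d) :
    IsLinkSimplicial (G.IsRIndepSet 3) S v := by
  intro A hSA hA hvA hvA'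
  have hh := H.isHeight
  have htri : ∀ w, w ∉ S → G.IsRIndepSet 3 (insert w S) → h w = d →
      ∃ x ∈ S, ∃ y ∈ S, G.Adj w x ∧ h x = d + 1 ∧ (G.Adj w y ∨ G.Adj x y) ∧
        G.IsConnSet {w, x, y} ∧ ({w, x, y} : Finset V).card = 3 := by
    intro w hwS hw hwd
    obtain ⟨x, hxS, hwx, hxd⟩ := H.exists_child w hwS hw hwd
    obtain ⟨y, hyS, hy, hyx⟩ := hM w hwS hw hwd x hxS hwx hxd
    refine ⟨x, hxS, y, hyS, hwx, hxd, hy, ?_,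
      card_triple hwx.ne (fun he => hwS (he ▸ hyS)) (Ne.symm hyx)⟩
    rcases hy with hy | hy
    · rw [Finset.insert_comm]
      exact isConnSet_triple hwx hy
    · exact isConnSet_triple hwx.symm hy
  obtain ⟨x, hxS, y, hyS, hvx, hxd, hy, hC, hcard⟩ := htri v hvS hv hvd
  have hCS : ∀ a ∈ ({v, x, y} : Finset V), ∀ b ∈ S, G.Adj a b → b ∈ ({v, x, y} : Finset V) :=
    fun a ha b hb hab => hv.mem_of_adj (by simp [Finset.insert_subset_iff, hxS, hyS]) hC hcard ha
      (Finset.mem_insert_of_mem hb) hab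
  have hCmem : ∀ u, u ∉ S → u ≠ v → u ∉ ({v, x, y} : Finset V) := by
    intro u huS huv
    simp only [Finset.mem_insert, Finset.mem_singleton, not_or]
    exact ⟨huv, fun he => huS (he ▸ hxS), fun he => huS (he ▸ hyS)⟩
  have hle : ∀ u ∈ A, u ∉ S → h u ≤ d := fun u hu huS => H.le u huS (hA.insert_of_mem hSA hu)
  -- The component `{v, x, y}` is full, so each new neighbour of it is an obstruction by itself; the
  -- point is that `A` contains at most one.
  have hunique : ∀ u₁ ∈ A, ∀ u₂ ∈ A, ∀ a₁ ∈ ({v, x, y} : Finset V),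
      ∀ a₂ ∈ ({v, x, y} : Finset V), u₁ ∉ S → u₂ ∉ S → G.Adj a₁ u₁ → G.Adj a₂ u₂ → u₁ = u₂ := by
    intro u₁ hu₁ u₂ hu₂ a₁ ha₁ a₂ ha₂ huS₁ huS₂ hau₁ hau₂
    by_contra hne
    have hd₁ := hle u₁ hu₁ huS₁
    have hd₂ := hle u₂ hu₂ huS₂
    have hx : ∀ u ∈ A, u ∉ S → ¬ G.Adj x u := by
      intro u hu huS hxu
      have := hle u hu huS
      exact hvA (hh.unique hvx.symm hxu (by omega) (by omega) ▸ hu)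
    have hor : ∀ a ∈ ({v, x, y} : Finset V), ∀ u ∈ A, u ∉ S → G.Adj a u →
        G.Adj v u ∨ G.Adj y u := by
      intro a ha u hu huS hau
      simp only [Finset.mem_insert, Finset.mem_singleton] at ha
      rcases ha with rfl | rfl | rfl
      · exact Or.inl hau
      · exact absurd hau (hx u hu huS)
      · exact Or.inr hau
    -- If `y` is not above `v`, both new vertices are adjacent to `y`, and they either lie strictly
    -- below it or form a triangle with it that has the arm `v, x`. If `y` is above `v`, both are
    -- adjacent to `v` and to each other; a top-level one already has a full component inside `S`
    -- and itself, so both lie strictly below `v`.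
    by_cases hyd : h y ≤ d
    · have hxy : ¬ G.Adj x y := fun hxy =>
        hvS (hh.unique hvx.symm hxy (by omega) (by omega) ▸ hyS)
      have hvy := hy.resolve_right hxy
      have hyu : ∀ a ∈ ({v, x, y} : Finset V), ∀ u ∈ A, u ∉ S → G.Adj a u → G.Adj y u := by
        intro a ha u hu huS hau
        refine (hor a ha u hu huS hau).elim (fun hvu => ?_) id
        have := hle u hu huS
        exact hh.adj hvy hvu (fun he => huS (he ▸ hyS)) (by omega) (by omega)
      have hy₁ := hyu a₁ ha₁ u₁ hu₁ huS₁ hau₁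
      have hy₂ := hyu a₂ ha₂ u₂ hu₂ huS₂ hau₂
      have hlow : ∀ z ∈ A, z ∈ ({u₁, y, u₂} : Finset V) → z ∉ S → h z < d := by
        intro z hzA hz hzS
        refine lt_of_le_of_ne (hle z hzA hzS) fun hzd => ?_
        obtain ⟨t, htS, hzt, htd⟩ := H.exists_child z hzS (hA.insert_of_mem hSA hzA) hzd
        have := hA.mem_of_adj (T := {u₁, y, u₂})
          (by simp [Finset.insert_subset_iff, hu₁, hu₂, hSA hyS]) (isConnSet_triple hy₁ hy₂)
          (card_triple hy₁.ne' hne hy₂.ne) hz (hSA htS) hzt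
        simp only [Finset.mem_insert, Finset.mem_singleton] at this
        rcases this with rfl | rfl | rfl
        · exact huS₁ htS
        · omega
        · exact huS₂ htS
      have h₁ := hlow u₁ hu₁ (by simp) huS₁
      have h₂ := hlow u₂ hu₂ (by simp) huS₂
      by_cases hyd' : h y = d
      · exact hne (hh.unique hy₁ hy₂ (by omega) (by omega))
      have := hh.le_succ hvy.symm
      have hu : G.Adj u₁ u₂ := hh.adj hy₁ hy₂ hne (by omega) (by omega)
      exact H.not_isArm A y u₁ u₂ v x hSA hA (hSA hyS) hu₁ hu₂ hy₁ hy₂ hu huS₁ huS₂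
        (H.isArm hvy.symm hvx (by omega) (by omega) hy₁.ne' (by omega))
    · have hyu : ∀ u ∈ A, u ∉ S → ¬ G.Adj y u := by
        intro u hu huS hyu
        have hud := hle u hu huS
        have := hh.le_succ hyu.symm
        have hvy : G.Adj v y := by
          rcases hy with hy | hy
          · exact hy
          · exact hh.adj hvx.symm hy (fun he => hvS (he ▸ hyS)) (by omega) (by omega)
        exact hvA (hh.unique hvy.symm hyu (by omega) (by omega) ▸ hu)
      have hv₁ := (hor a₁ ha₁ u₁ hu₁ huS₁ hau₁).resolve_right (hyu u₁ hu₁ huS₁)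
      have hv₂ := (hor a₂ ha₂ u₂ hu₂ huS₂ hau₂).resolve_right (hyu u₂ hu₂ huS₂)
      have hadj : G.Adj u₁ u₂ := hh.adj hv₁ hv₂ hne (by omega) (by omega)
      have hlow : ∀ u ∈ A, ∀ u' ∈ A, u ∉ S → u' ∉ S → G.Adj u u' → h u < d := by
        intro u hu u' hu' huS huS' huu'
        refine lt_of_le_of_ne (hle u hu huS) fun hud => ?_
        obtain ⟨s, hsS, t, htS, -, -, -, hD, hDc⟩ :=
          htri u huS (hA.insert_of_mem hSA hu) hud
        have := hA.mem_of_adj (T := {u, s, t})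
          (by simp [Finset.insert_subset_iff, hu, hSA hsS, hSA htS]) hD hDc (by simp) hu' huu'
        simp only [Finset.mem_insert, Finset.mem_singleton] at this
        rcases this with rfl | rfl | rfl
        · exact huu'.ne rfl
        · exact huS' hsS
        · exact huS' htS
      have h₁ := hlow u₁ hu₁ u₂ hu₂ huS₁ huS₂ hadj
      have h₂ := hlow u₂ hu₂ u₁ hu₁ huS₂ huS₁ hadj.symm
      exact hne (hh.unique hv₁ hv₂ (by omega) (by omega))
  have hmemA : ∀ z ∈ insert v A, z ≠ v → z ∈ A := fun z hz hzv =>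
    (Finset.mem_insert.1 hz).resolve_left hzv
  obtain ⟨u, huA, a, ha, hau, huC⟩ : ∃ u ∈ A, ∃ a ∈ ({v, x, y} : Finset V), G.Adj a u ∧
      u ∉ ({v, x, y} : Finset V) := by
    by_contra! hcon
    refine hvA' (hA.of_closed (P := {v, x, y}) hcard.le (by simp) hmemA fun a ha b hb hab => ?_)
    by_cases hbv : b = v
    · simp [hbv]
    · exact hcon b (hmemA b hb hbv) a ha hab
  have huS : u ∉ S := fun hu => huC (hCS a ha u hu hau)
  refine ⟨{u}, by simpa using ⟨huA, huS⟩, ?_, ?_⟩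
  · exact not_isRIndepSet_of_adj (T := {v, x, y})
      (by simp [Finset.insert_subset_iff, hxS, hyS]) hC hcard ha (by simp) hau huC
  · intro w hw
    rw [Finset.mem_singleton] at hw
    subst hw
    refine hA.of_closed (P := {v, x, y}) hcard.le (by simp)
      (fun z hz => hmemA z (Finset.mem_of_mem_erase hz)) fun b hb z hz hbz => ?_
    by_contra hzC
    have hzv : z ≠ v := by
      rintro rfl
      simp at hzC
    have hzA := hmemA z (Finset.mem_of_mem_erase hz) hzv
    have hzS : z ∉ S := fun h => hzC (hCS b hb z h hbz)
    exact Finset.ne_of_mem_erase hz (hunique z hzA w huA b hb a ha hzS huS hbz hau)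

theorem HasCliqueBranches.exists_isLinkSimplicial [Finite V] (hG : G.HasCliqueBranches)
    (hT : ¬ graphT3.IsIndContained G) (S : Finset V)
    (hS : ∃ v, v ∉ S ∧ G.IsRIndepSet 3 (insert v S)) :
    ∃ v, v ∉ S ∧ G.IsRIndepSet 3 (insert v S) ∧ IsLinkSimplicial (G.IsRIndepSet 3) S v := by
  by_contra! hcon
  have hN : ∀ v, v ∉ S → G.IsRIndepSet 3 (insert v S) → ¬ G.HasCliqueLink S v :=
    fun v hvS hv h => hcon v hvS hv h.isLinkSimplicial
  obtain ⟨h, hh⟩ := hG.exists_isHeight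
  obtain ⟨v, ⟨hvS, hv⟩, hmax⟩ :=
    (Set.toFinite {v | v ∉ S ∧ G.IsRIndepSet 3 (insert v S)}).exists_maximalFor h _ hS
  have hle : ∀ w, w ∉ S → G.IsRIndepSet 3 (insert w S) → h w ≤ h v := by
    intro w hwS hw
    by_contra hlt
    exact hlt (hmax ⟨hwS, hw⟩ (by omega))
  have H : G.IsTopLevel h S (h v) := by
    refine ⟨hh, hle, ?_, ?_⟩
    · intro w hwS hw hwd
      by_contra! hno
      have hlow : ∀ a, G.IsRIndepSet 3 (insert a S) → G.Adj w a → h a ≤ h w := by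
        intro a ha hwa
        by_cases haS : a ∈ S
        · have h1 := hno a haS hwa
          have h2 := hh.le_succ hwa
          omega
        · exact (hle a haS ha).trans hwd.ge
      exact hN w hwS hw fun a b ha hb hwa hwb hab =>
        hh.adj hwa hwb hab (hlow a ha hwa) (hlow b hb hwb)
    · intro A p b c w x hSA hA hp hb hc hpb hpc hbc hbS hcS harm
      obtain ⟨e, f, h1⟩ := exists_isArm hG hN hSA hA hb hp hc hbS hpb.symm hbc hpc
      obtain ⟨e', f', h2⟩ := exists_isArm hG hN hSA hA hc hp hb hcS hpc.symm hbc.symm hpb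
      exact hT (isIndContained_graphT3_of_isArm hG hpb hpc hbc harm h1 h2)
  by_cases hpair : ∃ w, w ∉ S ∧ G.IsRIndepSet 3 (insert w S) ∧ h w = h v ∧
      ∃ x ∈ S, G.Adj w x ∧ h x = h v + 1 ∧ ∀ y ∈ S, G.Adj w y ∨ G.Adj x y → y = x
  · obtain ⟨w, hwS, hw, hwd, x, hxS, hwx, hxd, hcl⟩ := hpair
    exact hcon w hwS hw (H.isLinkSimplicial_of_pair hwS hw hwd hxS hwx hxd hcl)
  · push Not at hpair
    exact hcon v hvS hv (H.isLinkSimplicial_of_triple hpair hvS hv rfl)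

end

/-! ### Conclusion for the complex -/

theorem isFacet_indComplex_iff {V : Type*} (G : SimpleGraph V) {r : ℕ} (hr : 1 ≤ r)
    (F : Finset V) :
    (G.indComplex r hr).toPreAbstractSimplicialComplex.IsFacet F ↔ Maximal (G.IsRIndepSet r) F := by
  have hfaces : ∀ A, A ∈ (G.indComplex r hr).toPreAbstractSimplicialComplex.augFaces ↔
      G.IsRIndepSet r A := by
    intro A
    refine ⟨fun hA => hA.elim (fun hA => ?_) fun hA => hA.2, fun hA => ?_⟩
    · exact G.isRIndepSet_of_card_le (by simp [hA])
    · rcases A.eq_empty_or_nonempty with hA' | hA'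
      · exact Or.inl hA'
      · exact Or.inr ⟨hA', hA⟩
  rw [IsFacet]
  simp only [hfaces]

theorem HasCliqueBranches.isShellable {V : Type*} [Finite V] {G : SimpleGraph V}
    (hG : G.HasCliqueBranches) (hT : ¬ graphT3.IsIndContained G) :
    (G.indComplex 3 (by norm_num)).toPreAbstractSimplicialComplex.IsShellable := by
  classical
  obtain ⟨r, hr⟩ := exists_rank_of_isLinkSimplicial (G.IsRIndepSet 3) (fun A B hBA hA => hA.mono hBA)
    (fun S _ => hG.exists_isLinkSimplicial hT S) ∅ (G.isRIndepSet_of_card_le (by simp))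
  refine isShellable_of_rank _ r fun F F' hF hF' hne hle => ?_
  rw [isFacet_indComplex_iff] at hF hF'
  obtain ⟨F'', h1, -, h2⟩ := hr F F' hF hF' (Finset.empty_subset _) (Finset.empty_subset _) hne hle
  exact ⟨F'', (isFacet_indComplex_iff _ _ _).2 h1, h2⟩

theorem IsAcyclic.not_isIndContained_graphT3 {V : Type*} {G : SimpleGraph V} (hG : G.IsAcyclic) :
    ¬ graphT3.IsIndContained G := by
  classical
  rintro ⟨f⟩
  have h1 : G.Adj (f 2) (f 3) := f.map_rel_iff.2 (by simp [graphT3])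
  have h2 : G.Adj (f 2) (f 4) := f.map_rel_iff.2 (by simp [graphT3])
  have h3 : G.Adj (f 3) (f 4) := f.map_rel_iff.2 (by simp [graphT3])
  exact h3.ne (hG.eq_of_isConnSet {f 3, f 4} h1 h2 (isConnSet_pair h3) (by simp) (by simp)
    (by simp [h1.ne, h2.ne]))

end SimpleGraph

theorem theorem4p10 {V : Type*} [Finite V] (G : SimpleGraph V) :
    (G.IsBlockGraph → ¬ SimpleGraph.graphT3.IsIndContained G →
      (G.indComplex 3 (by norm_num)).toPreAbstractSimplicialComplex.IsShellable) ∧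
    (G.IsAcyclic →
      (G.indComplex 3 (by norm_num)).toPreAbstractSimplicialComplex.IsShellable) :=
  ⟨fun hG hT => hG.hasCliqueBranches.isShellable hT,
    fun hG => hG.hasCliqueBranches.isShellable hG.not_isIndContained_graphT3⟩
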